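/- Let $(B,g_B)$ and $(F,g_F)$ be smooth pseudo-Riemannian manifolds without boundary, of dimensions $m\ge 1$ and $k\ge 0$ (of arbitrary signature: $g_B,g_F$ are smooth fields of symmetric nondegenerate bilinear forms on the tangent spaces), and let $c,w\colon B\to(0,\infty)$ be smooth functions. Consider on $B\times F$ the metric $$g = c^2 g_B + w^2 g_F,$$ that is, $g=(c\circ\pi_B)^2\,\pi_B^*g_B+(w\circ\pi_B)^2\,\pi_F^*g_F$ with the projections $\pi_B,\pi_F$ of $B\times F$ (the base conformal warped product with conformal factor $c$ and warping function $w$). Let $S$, $S_B$, $S_F$ be the scalar curvatures of $(B\times F,g)$, $(B,g_B)$, $(F,g_F)$ (so that round spheres of dimension at least two have positive scalar curvature), let $\nabla^B$ be the gradient and $\Delta_B=\nabla^i\nabla_i$ the Laplace–Beltrami operator of $(B,g_B)$. Then at every point of $B\times F$ (functions on $B$ and on $F$ being composed with the projections) $$c^2S = S_B + S_F\frac{c^2}{w^2} - 2(m-1)\frac{\Delta_B c}{c} - 2k\frac{\Delta_B w}{w} - (m-4)(m-1)\frac{g_B(\nabla^Bc,\nabla^Bc)}{c^2} - 2k(m-2)\frac{g_B(\nabla^Bw,\nabla^Bc)}{wc}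 - k(k-1)\frac{g_B(\nabla^Bw,\nabla^Bw)}{w^2}.$$ -/

import Mathlib

set_option maxSynthPendingDepth 3

open scoped Manifold ContDiff Bundle

noncomputable section

/-! ### Pseudo-Riemannian metrics -/

/-- A smooth pseudo-Riemannian metric on a manifold `M`: a smooth field of symmetric nondegenerate
bilinear forms on the tangent spaces. -/
structure PseudoRiemannianMetric {E : Type*} [NormedAddCommGroup E] [NormedSpace ℝ E]
    {H : Type*} [TopologicalSpace H] (I : ModelWithCorners ℝ E H)
    (M : Type*) [TopologicalSpace M] [ChartedSpace H M] [IsManifold I ∞ M] where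
  /-- The bilinear form on the tangent space at `x`. -/
  val (x : M) : TangentSpace I x →L[ℝ] TangentSpace I x →L[ℝ] ℝ
  symm (x : M) (v w : TangentSpace I x) : val x v w = val x w v
  nondegenerate (x : M) (v : TangentSpace I x) (hv : ∀ w, val x v w = 0) : v = 0
  contMDiff : ContMDiff I (I.prod 𝓘(ℝ, E →L[ℝ] E →L[ℝ] ℝ)) ∞
    (fun x ↦ Bundle.TotalSpace.mk' (E →L[ℝ] E →L[ℝ] ℝ)
      (E := fun x : M ↦ TangentSpace I x →L[ℝ] TangentSpace I x →L[ℝ] ℝ) x (val x))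

/-! ### Geometry of a field of bilinear forms on a vector space

Here `G : E → E →L[ℝ] E →L[ℝ] ℝ` is a metric in coordinates: `G z u v = g_z(u, v)`. -/

namespace LocalGeometry

variable {E : Type*} [NormedAddCommGroup E] [NormedSpace ℝ E]

/-- Raising an index with the bilinear form `g`: the vector `sharp g α` represents the linear form
`α`, that is, `g (sharp g α) v = α v` (for `g` nondegenerate, `E` finite dimensional). -/
def sharp (g : E →L[ℝ] E →L[ℝ] ℝ) : (E →L[ℝ] ℝ) →L[ℝ] E :=
  ContinuousLinearMap.inverse g

theorem isInvertible_of_nondegenerate [FiniteDimensional ℝ E] (g : E →L[ℝ] E →L[ℝ] ℝ)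
    (hg : ∀ v, (∀ w, g v w = 0) → v = 0) : g.IsInvertible := by
  have hinj : Function.Injective (g : E →ₗ[ℝ] (E →L[ℝ] ℝ)) := by
    rw [injective_iff_map_eq_zero]
    intro v hv
    exact hg v fun w ↦ by simpa using congrArg (fun α : E →L[ℝ] ℝ ↦ α w) hv
  have hdim : Module.finrank ℝ E = Module.finrank ℝ (E →L[ℝ] ℝ) := by
    rw [← (LinearMap.toContinuousLinearMap (𝕜 := ℝ) (E := E) (F' := ℝ)).finrank_eq]
    exact (Subspace.dual_finrank_eq (K := ℝ) (V := E)).symm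
  exact ⟨(LinearEquiv.ofInjectiveOfFinrankEq _ hinj hdim).toContinuousLinearEquiv, by ext; rfl⟩

/-- The trace of the bilinear form `T` with respect to the metric `g`, in indices
`g^{ij} T_{ij}`. -/
def metricTrace (g T : E →L[ℝ] E →L[ℝ] ℝ) : ℝ :=
  LinearMap.trace ℝ E ((sharp g ∘L T : E →L[ℝ] E) : E →ₗ[ℝ] E)

/-- Christoffel symbols of the first kind, `½ (∂_u g(v, w) + ∂_v g(u, w) - ∂_w g(u, v))`;
see `christoffelFirst_apply`. -/
def christoffelFirst (G : E → E →L[ℝ] E →L[ℝ] ℝ) (z : E) : E →L[ℝ] E →L[ℝ] E →L[ℝ] ℝ :=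
  (1 / 2 : ℝ) • (fderiv ℝ G z + (fderiv ℝ G z).flip -
    ((ContinuousLinearMap.flipₗᵢ ℝ E E ℝ).toContinuousLinearEquiv :
      (E →L[ℝ] E →L[ℝ] ℝ) →L[ℝ] (E →L[ℝ] E →L[ℝ] ℝ)) ∘L (fderiv ℝ G z).flip)

theorem christoffelFirst_apply (G : E → E →L[ℝ] E →L[ℝ] ℝ) (z u v w : E) :
    christoffelFirst G z u v w =
      1 / 2 * (fderiv ℝ G z u v w + fderiv ℝ G z v u w - fderiv ℝ G z w u v) := by
  simp [christoffelFirst]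

/-- Christoffel symbols of the second kind `Γ_z(u, v)`, in indices `Γ^k_{ij} u^i v^j`: the
Levi-Civita connection is `∇_u Y = ∂_u Y + Γ(u, Y)`. -/
def christoffel (G : E → E →L[ℝ] E →L[ℝ] ℝ) (z : E) : E →L[ℝ] E →L[ℝ] E :=
  ContinuousLinearMap.compL ℝ E (E →L[ℝ] ℝ) E (sharp (G z)) ∘L christoffelFirst G z

theorem christoffel_apply (G : E → E →L[ℝ] E →L[ℝ] ℝ) (z u v : E) :
    christoffel G z u v = sharp (G z) (christoffelFirst G z u v) := rfl

/-- The Riemann curvature `u ↦ R(u, v) x`, with the convention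
`R(X, Y) Z = ∇_X ∇_Y Z - ∇_Y ∇_X Z - ∇_[X,Y] Z`. -/
def riemann (G : E → E →L[ℝ] E →L[ℝ] ℝ) (z v x : E) : E →ₗ[ℝ] E where
  toFun u := fderiv ℝ (christoffel G) z u v x - fderiv ℝ (christoffel G) z v u x
    + christoffel G z u (christoffel G z v x) - christoffel G z v (christoffel G z u x)
  map_add' u u' := by simp; abel
  map_smul' a u := by simp [smul_sub, smul_add]

/-- The Ricci tensor `Ric(v, x) = trace (u ↦ R(u, v) x)`. -/
def ricci [FiniteDimensional ℝ E] (G : E → E →L[ℝ] E →L[ℝ] ℝ) (z : E) : E →L[ℝ] E →L[ℝ] ℝ :=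
  LinearMap.toContinuousBilinearMap <| LinearMap.mk₂ ℝ
    (fun v x ↦ LinearMap.trace ℝ E (riemann G z v x))
    (fun v v' x ↦ by
      rw [← map_add]; congr 1; ext u; simp [riemann]; abel)
    (fun a v x ↦ by
      rw [← map_smul]; congr 1; ext u; simp [riemann, smul_sub, smul_add])
    (fun v x x' ↦ by
      rw [← map_add]; congr 1; ext u; simp [riemann]; abel)
    (fun a v x ↦ by
      rw [← map_smul]; congr 1; ext u; simp [riemann, smul_sub, smul_add])

theorem ricci_apply [FiniteDimensional ℝ E] (G : E → E →L[ℝ] E →L[ℝ] ℝ) (z v x : E) :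
    ricci G z v x = LinearMap.trace ℝ E (riemann G z v x) := rfl

/-- The Hessian `∇(∇f)`, in indices `∂_i ∂_j f - Γ^k_{ij} ∂_k f`; see `hessian_apply`. -/
def hessian (G : E → E →L[ℝ] E →L[ℝ] ℝ) (f : E → ℝ) (z : E) : E →L[ℝ] E →L[ℝ] ℝ :=
  fderiv ℝ (fderiv ℝ f) z - ContinuousLinearMap.compL ℝ E E ℝ (fderiv ℝ f z) ∘L christoffel G z

theorem hessian_apply (G : E → E →L[ℝ] E →L[ℝ] ℝ) (f : E → ℝ) (z u v : E) :
    hessian G f z u v = fderiv ℝ (fderiv ℝ f) z u v - fderiv ℝ f z (christoffel G z u v) := rfl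

end LocalGeometry

/-! ### Geometry of a pseudo-Riemannian manifold -/

namespace PseudoRiemannianMetric

section Manifold

variable {E : Type*} [NormedAddCommGroup E] [NormedSpace ℝ E]
  {H : Type*} [TopologicalSpace H] {I : ModelWithCorners ℝ E H}
  {M : Type*} [TopologicalSpace M] [ChartedSpace H M] [IsManifold I ∞ M]

/-- The expression of the metric in the chart `φ` of `M` at `x₀`:
`(u, v) ↦ g_{φ⁻¹ z} (dφ⁻¹ u, dφ⁻¹ v)` for `z` in the image of the chart. -/
def inChart (g : PseudoRiemannianMetric I M) (x₀ : M) (z : E) : E →L[ℝ] E →L[ℝ] ℝ :=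
  let D : E →L[ℝ] TangentSpace I ((extChartAt I x₀).symm z) :=
    mfderiv 𝓘(ℝ, E) I (extChartAt I x₀).symm z
  ContinuousLinearMap.precomp ℝ D ∘L g.val ((extChartAt I x₀).symm z) ∘L D

/-- The scalar curvature of a pseudo-Riemannian manifold without boundary: the metric trace of the
Ricci tensor of the Levi-Civita connection, computed at `x` in the chart at `x`. -/
def scalarCurvature [FiniteDimensional ℝ E] (g : PseudoRiemannianMetric I M) (x : M) : ℝ :=
  LocalGeometry.metricTrace (g.inChart x (extChartAt I x x))
    (LocalGeometry.ricci (g.inChart x) (extChartAt I x x))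

/-- The Laplace–Beltrami operator `Δ f = ∇^i ∇_i f` of a pseudo-Riemannian manifold without
boundary: the metric trace of the Hessian, computed at `x` in the chart at `x`. -/
def laplacian (g : PseudoRiemannianMetric I M) (f : M → ℝ) (x : M) : ℝ :=
  LocalGeometry.metricTrace (g.inChart x (extChartAt I x x))
    (LocalGeometry.hessian (g.inChart x) (f ∘ (extChartAt I x).symm) (extChartAt I x x))

/-- The gradient of `f`: the vector field with `g (grad f, v) = df v`. -/
def grad (g : PseudoRiemannianMetric I M) (f : M → ℝ) (x : M) : TangentSpace I x :=
  ContinuousLinearMap.inverse (g.val x) (mfderiv I 𝓘(ℝ, ℝ) f x : TangentSpace I x →L[ℝ] ℝ)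

theorem isInvertible_val [FiniteDimensional ℝ E] (g : PseudoRiemannianMetric I M) (x : M) :
    (g.val x).IsInvertible :=
  LocalGeometry.isInvertible_of_nondegenerate (E := E) (g.val x) (g.nondegenerate x)

theorem val_grad [FiniteDimensional ℝ E] (g : PseudoRiemannianMetric I M) (f : M → ℝ) (x : M)
    (v : TangentSpace I x) :
    g.val x (g.grad f x) v = (mfderiv I 𝓘(ℝ, ℝ) f x : TangentSpace I x →L[ℝ] ℝ) v := by
  obtain ⟨e, he⟩ := g.isInvertible_val x
  rw [grad, ← he, ContinuousLinearMap.inverse_equiv]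
  exact congrArg (fun α : TangentSpace I x →L[ℝ] ℝ ↦ α v) (e.apply_symm_apply _)

end Manifold

/-! ### Base conformal warped products -/

section Product

variable {E : Type*} [NormedAddCommGroup E] [NormedSpace ℝ E]
  {H : Type*} [TopologicalSpace H] {I : ModelWithCorners ℝ E H}
  {M : Type*} [TopologicalSpace M] [ChartedSpace H M] [IsManifold I ∞ M]
  {E' : Type*} [NormedAddCommGroup E'] [NormedSpace ℝ E']
  {H' : Type*} [TopologicalSpace H'] {I' : ModelWithCorners ℝ E' H'}
  {M' : Type*} [TopologicalSpace M'] [ChartedSpace H' M'] [IsManifold I' ∞ M']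

/-- The pullback `f^* g` of the metric tensor `g`, a field of bilinear forms. -/
def pullback (g : PseudoRiemannianMetric I' M') (f : M → M') (x : M) :
    TangentSpace I x →L[ℝ] TangentSpace I x →L[ℝ] ℝ :=
  ContinuousLinearMap.precomp ℝ (mfderiv I I' f x) ∘L g.val (f x) ∘L mfderiv I I' f x

set_option linter.unusedSectionVars false in
theorem pullback_apply (g : PseudoRiemannianMetric I' M') (f : M → M') (x : M)
    (u v : TangentSpace I x) :
    g.pullback f x u v = g.val (f x) (mfderiv I I' f x u) (mfderiv I I' f x v) := rfl

theorem inCoordinates_pullback (g : PseudoRiemannianMetric I' M') (f : M → M') (x₀ x : M)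
    (hx : x ∈ (trivializationAt E (TangentSpace I) x₀).baseSet)
    (hfx : f x ∈ (trivializationAt E' (TangentSpace I') (f x₀)).baseSet) :
    ContinuousLinearMap.inCoordinates E (TangentSpace I) (E →L[ℝ] ℝ)
        (fun y : M ↦ TangentSpace I y →L[ℝ] ℝ) x₀ x x₀ x (g.pullback f x) =
      ContinuousLinearMap.precomp ℝ (inTangentCoordinates I I' id f (mfderiv I I' f) x₀ x) ∘L
      (ContinuousLinearMap.inCoordinates E' (TangentSpace I') (E' →L[ℝ] ℝ)
        (fun y : M' ↦ TangentSpace I' y →L[ℝ] ℝ) (f x₀) (f x) (f x₀) (f x) (g.val (f x))) ∘L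
      inTangentCoordinates I I' id f (mfderiv I I' f) x₀ x := by
  have key (u : E) : (trivializationAt E' (TangentSpace I') (f x₀)).symm (f x)
      (inTangentCoordinates I I' id f (mfderiv I I' f) x₀ x u) =
      mfderiv I I' f x ((trivializationAt E (TangentSpace I) x₀).symm x u) := by
    rw [← Bundle.Trivialization.symmL_apply (R := ℝ) _ hfx,
      ← Bundle.Trivialization.symmL_apply (R := ℝ) _ hx]
    exact (trivializationAt E' (TangentSpace I') (f x₀)).symmL_continuousLinearMapAt (R := ℝ) hfx _
  ext u v
  have hL := inCoordinates_apply_eq₂ (𝕜 := ℝ) (F₃ := ℝ) (E₃ := Bundle.Trivial M ℝ)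
    (ϕ := g.pullback f x) (v := u) (w := v) hx hx (Set.mem_univ _)
  have hR := inCoordinates_apply_eq₂ (𝕜 := ℝ) (F₃ := ℝ) (E₃ := Bundle.Trivial M' ℝ)
    (ϕ := g.val (f x)) (v := inTangentCoordinates I I' id f (mfderiv I I' f) x₀ x u)
    (w := inTangentCoordinates I I' id f (mfderiv I I' f) x₀ x v) hfx hfx (Set.mem_univ _)
  rw [key, key] at hR
  exact hL.trans hR.symm

theorem contMDiff_pullback (g : PseudoRiemannianMetric I' M') {f : M → M'}
    (hf : ContMDiff I I' ∞ f) :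
    ContMDiff I (I.prod 𝓘(ℝ, E →L[ℝ] E →L[ℝ] ℝ)) ∞
      (fun x ↦ Bundle.TotalSpace.mk' (E →L[ℝ] E →L[ℝ] ℝ)
        (E := fun x : M ↦ TangentSpace I x →L[ℝ] TangentSpace I x →L[ℝ] ℝ) x
        (g.pullback f x)) := by
  intro x₀
  have hg := g.contMDiff (f x₀)
  rw [contMDiffAt_hom_bundle] at hg ⊢
  refine ⟨contMDiffAt_id, ?_⟩
  have hG := hg.2.comp x₀ (hf x₀)
  have hD := (hf x₀).mfderiv_const (m := ∞) le_rfl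
  have h₁ : ∀ᶠ x in nhds x₀, x ∈ (trivializationAt E (TangentSpace I) x₀).baseSet :=
    (trivializationAt E (TangentSpace I) x₀).open_baseSet.mem_nhds
      (FiberBundle.mem_baseSet_trivializationAt' x₀)
  have h₂ : ∀ᶠ x in nhds x₀, f x ∈ (trivializationAt E' (TangentSpace I') (f x₀)).baseSet :=
    (hf x₀).continuousAt.eventually
      ((trivializationAt E' (TangentSpace I') (f x₀)).open_baseSet.mem_nhds
      (FiberBundle.mem_baseSet_trivializationAt' (f x₀)))
  have hP := (ContMDiffAt.clm_precomp (F₃ := ℝ) hD).clm_comp (hG.clm_comp hD)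
  refine hP.congr_of_eventuallyEq ?_
  filter_upwards [h₁, h₂] with x hx hfx
  exact g.inCoordinates_pullback f x₀ x hx hfx

/-- The metric `c² g_B + w² g_F` of the base conformal warped product `B ×_{[c, w]} F`, that is,
`c² π_B^* g_B + w² π_F^* g_F` on `B × F`, for smooth positive functions `c, w` on `B = M`, with
`F = M'`. -/
def baseConformalWarped (gB : PseudoRiemannianMetric I M) (gF : PseudoRiemannianMetric I' M')
    (c w : M → ℝ) (hc : ContMDiff I 𝓘(ℝ, ℝ) ∞ c) (hw : ContMDiff I 𝓘(ℝ, ℝ) ∞ w)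
    (hc0 : ∀ x, 0 < c x) (hw0 : ∀ x, 0 < w x) :
    PseudoRiemannianMetric (I.prod I') (M × M') where
  val p := c p.1 ^ 2 • gB.pullback (I := I.prod I') Prod.fst p
    + w p.1 ^ 2 • gF.pullback (I := I.prod I') Prod.snd p
  symm p u v := by
    change c p.1 ^ 2 • gB.pullback (I := I.prod I') Prod.fst p u v
        + w p.1 ^ 2 • gF.pullback (I := I.prod I') Prod.snd p u v
      = c p.1 ^ 2 • gB.pullback (I := I.prod I') Prod.fst p v u
        + w p.1 ^ 2 • gF.pullback (I := I.prod I') Prod.snd p v u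
    rw [pullback_apply, pullback_apply, pullback_apply, pullback_apply, gB.symm, gF.symm]
  nondegenerate p u hu := by
    have hu' (v : E × E') : c p.1 ^ 2 * gB.val p.1 (u : E × E').1 v.1
        + w p.1 ^ 2 * gF.val p.2 (u : E × E').2 v.2 = 0 := by
      have h : c p.1 ^ 2 • gB.val p.1 (mfderiv (I.prod I') I Prod.fst p u)
            (mfderiv (I.prod I') I Prod.fst p (v : TangentSpace (I.prod I') p))
          + w p.1 ^ 2 • gF.val p.2 (mfderiv (I.prod I') I' Prod.snd p u)
            (mfderiv (I.prod I') I' Prod.snd p (v : TangentSpace (I.prod I') p)) = 0 := hu v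
      rw [mfderiv_fst, mfderiv_snd] at h
      exact h
    have h₁ : (u : E × E').1 = 0 := gB.nondegenerate p.1 _ fun v ↦ by
      have h := hu' (v, 0)
      have h0 : gF.val p.2 (u : E × E').2 (0 : E') = 0 := map_zero _
      simp only [h0, mul_zero, add_zero, mul_eq_zero] at h
      exact h.resolve_left (pow_ne_zero 2 (hc0 p.1).ne')
    have h₂ : (u : E × E').2 = 0 := gF.nondegenerate p.2 _ fun v ↦ by
      have h := hu' (0, v)
      have h0 : gB.val p.1 (u : E × E').1 (0 : E) = 0 := map_zero _
      simp only [h0, mul_zero, zero_add, mul_eq_zero] at h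
      exact h.resolve_left (pow_ne_zero 2 (hw0 p.1).ne')
    exact Prod.ext h₁ h₂
  contMDiff :=
    ContMDiff.add_section
      (((hc.comp contMDiff_fst).pow 2).smul_section (gB.contMDiff_pullback contMDiff_fst))
      (((hw.comp contMDiff_fst).pow 2).smul_section (gF.contMDiff_pullback contMDiff_snd))

end Product

end PseudoRiemannianMetric

end

noncomputable section

open Filter Topology

namespace LocalGeometry

variable {E : Type*} [NormedAddCommGroup E] [NormedSpace ℝ E]

/-- `G` is, near `z`, a pseudo-Riemannian metric of class `C²` in coordinates. -/
structure IsMetricAt (G : E → E →L[ℝ] E →L[ℝ] ℝ) (z : E) : Prop where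
  contDiffAt : ContDiffAt ℝ 2 G z
  eventually_symm : ∀ᶠ y in 𝓝 z, ∀ u v, G y u v = G y v u
  isInvertible : (G z).IsInvertible

section sharp

variable {g : E →L[ℝ] E →L[ℝ] ℝ}

theorem apply_sharp (hg : g.IsInvertible) (α : E →L[ℝ] ℝ) : g (sharp g α) = α := by
  obtain ⟨e, rfl⟩ := hg
  simp [sharp]

theorem sharp_apply (hg : g.IsInvertible) (v : E) : sharp g (g v) = v := by
  obtain ⟨e, rfl⟩ := hg
  simp [sharp]

theorem eq_of_apply_eq (hg : g.IsInvertible) {v v' : E} (h : ∀ w, g v w = g v' w) : v = v' := by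
  rw [← sharp_apply hg v, ← sharp_apply hg v', ContinuousLinearMap.ext h]

theorem sharp_eq_iff (hg : g.IsInvertible) {α : E →L[ℝ] ℝ} {v : E} :
    sharp g α = v ↔ α = g v :=
  ⟨fun h ↦ by rw [← h, apply_sharp hg], fun h ↦ by rw [h, sharp_apply hg]⟩

theorem isInvertible_smul {a : ℝ} (ha : a ≠ 0) (hg : g.IsInvertible) : (a • g).IsInvertible := by
  obtain ⟨e, rfl⟩ := hg
  exact ⟨(ContinuousLinearEquiv.smulLeft (Units.mk0 a ha) : E ≃L[ℝ] E).trans e,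
    by ext; simp [Units.smul_def]⟩

theorem sharp_smul {a : ℝ} (ha : a ≠ 0) (hg : g.IsInvertible) :
    sharp (a • g) = a⁻¹ • sharp g := by
  ext α
  rw [sharp_eq_iff (isInvertible_smul ha hg)]
  ext v
  simp [apply_sharp hg, ha]

theorem apply_sharp_comm (hg : g.IsInvertible) (hs : ∀ u v, g u v = g v u) (α β : E →L[ℝ] ℝ) :
    α (sharp g β) = β (sharp g α) := by
  conv_lhs => rw [← apply_sharp hg α]
  conv_rhs => rw [← apply_sharp hg β]
  exact hs _ _

end sharp

section trace

variable {g : E →L[ℝ] E →L[ℝ] ℝ}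

theorem metricTrace_add (g S T : E →L[ℝ] E →L[ℝ] ℝ) :
    metricTrace g (S + T) = metricTrace g S + metricTrace g T := by
  simp [metricTrace]

theorem metricTrace_smul (g : E →L[ℝ] E →L[ℝ] ℝ) (a : ℝ) (T : E →L[ℝ] E →L[ℝ] ℝ) :
    metricTrace g (a • T) = a * metricTrace g T := by
  simp [metricTrace]

theorem metricTrace_sub (g S T : E →L[ℝ] E →L[ℝ] ℝ) :
    metricTrace g (S - T) = metricTrace g S - metricTrace g T := by
  simp [metricTrace]

theorem metricTrace_self [FiniteDimensional ℝ E] (hg : g.IsInvertible) :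
    metricTrace g g = Module.finrank ℝ E := by
  rw [metricTrace, ← LinearMap.trace_id]
  congr 1
  ext v
  exact sharp_apply hg v

theorem metricTrace_smulRight [FiniteDimensional ℝ E] (g : E →L[ℝ] E →L[ℝ] ℝ) (α β : E →L[ℝ] ℝ) :
    metricTrace g (α.smulRight β) = α (sharp g β) := by
  rw [metricTrace]
  have : ((sharp g ∘L α.smulRight β : E →L[ℝ] E) : E →ₗ[ℝ] E) =
      (α : E →ₗ[ℝ] ℝ).smulRight (sharp g β) := by
    ext v; simp
  rw [this, LinearMap.trace_smulRight]
  rfl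

theorem metricTrace_smul_left {a : ℝ} (ha : a ≠ 0) (hg : g.IsInvertible)
    (T : E →L[ℝ] E →L[ℝ] ℝ) : metricTrace (a • g) T = a⁻¹ * metricTrace g T := by
  rw [metricTrace, sharp_smul ha hg, metricTrace, ← smul_eq_mul, ← map_smul]
  rfl

end trace

namespace IsMetricAt

variable {G : E → E →L[ℝ] E →L[ℝ] ℝ} {z : E}

theorem symm (h : IsMetricAt G z) (u v : E) : G z u v = G z v u :=
  h.eventually_symm.self_of_nhds u v

theorem differentiableAt (h : IsMetricAt G z) : DifferentiableAt ℝ G z :=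
  h.contDiffAt.differentiableAt two_ne_zero

theorem eventually [CompleteSpace E] (h : IsMetricAt G z) : ∀ᶠ y in 𝓝 z, IsMetricAt G y := by
  have h₁ := h.contDiffAt.eventually (by simp)
  have h₃ : ∀ᶠ y in 𝓝 z, (G y).IsInvertible := by
    obtain ⟨e, he⟩ := h.isInvertible
    have := ContinuousLinearEquiv.nhds e
    rw [he] at this
    filter_upwards [h.contDiffAt.continuousAt this] with y hy using hy
  filter_upwards [h₁, h.eventually_symm.eventually_nhds, h₃] with y a b c
  exact ⟨a, b, c⟩

theorem contDiffAt_sharp [CompleteSpace E] (h : IsMetricAt G z) :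
    ContDiffAt ℝ 2 (fun y ↦ sharp (G y)) z :=
  h.isInvertible.contDiffAt_map_inverse.comp z h.contDiffAt

theorem fderiv_symm (h : IsMetricAt G z) (u v w : E) :
    fderiv ℝ G z u v w = fderiv ℝ G z u w v := by
  have key (a b : E) : HasFDerivAt (fun y ↦ G y a b)
      (((ContinuousLinearMap.apply ℝ ℝ b).comp (ContinuousLinearMap.apply ℝ (E →L[ℝ] ℝ) a)).comp
        (fderiv ℝ G z)) z :=
    ((ContinuousLinearMap.apply ℝ ℝ b).comp
      (ContinuousLinearMap.apply ℝ (E →L[ℝ] ℝ) a)).hasFDerivAt.comp z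
        h.differentiableAt.hasFDerivAt
  have e : (fun y ↦ G y w v) =ᶠ[𝓝 z] fun y ↦ G y v w := by
    filter_upwards [h.eventually_symm] with y hy using hy w v
  have := ((key v w).congr_of_eventuallyEq e).unique (key w v)
  exact congrArg (fun L : E →L[ℝ] ℝ ↦ L u) this

theorem christoffel_symm (h : IsMetricAt G z) (u v : E) :
    christoffel G z u v = christoffel G z v u := by
  rw [christoffel_apply, christoffel_apply]
  congr 1
  ext w
  rw [christoffelFirst_apply, christoffelFirst_apply, h.fderiv_symm w u v]
  ring

theorem apply_christoffel (h : IsMetricAt G z) (u v w : E) :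
    G z (christoffel G z u v) w = christoffelFirst G z u v w := by
  rw [christoffel_apply, apply_sharp h.isInvertible]

/-- The Levi-Civita connection is compatible with the metric. -/
theorem fderiv_apply (h : IsMetricAt G z) (u v w : E) :
    fderiv ℝ G z u v w = G z (christoffel G z u v) w + G z (christoffel G z u w) v := by
  rw [h.apply_christoffel, h.apply_christoffel, christoffelFirst_apply, christoffelFirst_apply,
    h.fderiv_symm u w v, h.fderiv_symm w u v, h.fderiv_symm v u w]
  ring

theorem differentiableAt_christoffel [CompleteSpace E] (h : IsMetricAt G z) :
    DifferentiableAt ℝ (christoffel G) z := by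
  have h₁ : DifferentiableAt ℝ (fderiv ℝ G) z :=
    (h.contDiffAt.fderiv_right (m := 1) (by norm_num)).differentiableAt one_ne_zero
  have h₂ : DifferentiableAt ℝ (fun y ↦ sharp (G y)) z :=
    h.contDiffAt_sharp.differentiableAt two_ne_zero
  have h₃ : DifferentiableAt ℝ (fun y ↦ (fderiv ℝ G y).flip) z :=
    (ContinuousLinearMap.flipₗᵢ ℝ E E (E →L[ℝ] ℝ)).toContinuousLinearEquiv.differentiableAt.comp z
      h₁
  have h₄ : DifferentiableAt ℝ (christoffelFirst G) z :=
    ((h₁.add h₃).sub ((differentiableAt_const ((ContinuousLinearMap.flipₗᵢ ℝ E E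
      ℝ).toContinuousLinearEquiv : (E →L[ℝ] E →L[ℝ] ℝ) →L[ℝ] (E →L[ℝ] E →L[ℝ] ℝ))).clm_comp
        h₃)).const_smul (1 / 2 : ℝ)
  exact ((ContinuousLinearMap.differentiableAt _).comp z h₂).clm_comp h₄

end IsMetricAt

theorem christoffelFirst_congr {G G' : E → E →L[ℝ] E →L[ℝ] ℝ} {z : E} (h : G =ᶠ[𝓝 z] G') :
    christoffelFirst G z = christoffelFirst G' z := by
  rw [christoffelFirst, christoffelFirst, h.fderiv_eq]

theorem christoffel_congr {G G' : E → E →L[ℝ] E →L[ℝ] ℝ} {z : E} (h : G =ᶠ[𝓝 z] G') :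
    christoffel G z = christoffel G' z := by
  rw [christoffel, christoffel, christoffelFirst_congr h, h.self_of_nhds]

theorem christoffel_eventuallyEq {G G' : E → E →L[ℝ] E →L[ℝ] ℝ} {z : E} (h : G =ᶠ[𝓝 z] G') :
    christoffel G =ᶠ[𝓝 z] christoffel G' := by
  filter_upwards [h.eventuallyEq_nhds] with y hy using christoffel_congr hy

theorem riemann_congr {G G' : E → E →L[ℝ] E →L[ℝ] ℝ} {z : E} (h : G =ᶠ[𝓝 z] G') (v x : E) :
    riemann G z v x = riemann G' z v x := by
  ext u
  simp only [riemann, LinearMap.coe_mk, AddHom.coe_mk, (christoffel_eventuallyEq h).fderiv_eq,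
    christoffel_congr h]

theorem ricci_congr [FiniteDimensional ℝ E] {G G' : E → E →L[ℝ] E →L[ℝ] ℝ} {z : E}
    (h : G =ᶠ[𝓝 z] G') : ricci G z = ricci G' z := by
  ext v x
  rw [ricci_apply, ricci_apply, riemann_congr h]

theorem riemann_apply (G : E → E →L[ℝ] E →L[ℝ] ℝ) (z u v x : E) :
    riemann G z v x u = fderiv ℝ (christoffel G) z u v x - fderiv ℝ (christoffel G) z v u x
      + christoffel G z u (christoffel G z v x) - christoffel G z v (christoffel G z u x) := rfl

/-- The scalar curvature of a metric in coordinates. -/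
def scalar [FiniteDimensional ℝ E] (G : E → E →L[ℝ] E →L[ℝ] ℝ) (z : E) : ℝ :=
  metricTrace (G z) (ricci G z)

/-- The Laplace–Beltrami operator of a metric in coordinates. -/
def laplace (G : E → E →L[ℝ] E →L[ℝ] ℝ) (f : E → ℝ) (z : E) : ℝ :=
  metricTrace (G z) (hessian G f z)

theorem scalar_congr [FiniteDimensional ℝ E] {G G' : E → E →L[ℝ] E →L[ℝ] ℝ} {z : E}
    (h : G =ᶠ[𝓝 z] G') : scalar G z = scalar G' z := by
  rw [scalar, scalar, ricci_congr h, h.self_of_nhds]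

/-! ### Conformal change -/

section Conformal

variable {G : E → E →L[ℝ] E →L[ℝ] ℝ} {φ : E → ℝ} {z : E}

/-- The conformal metric `e^{2φ} G`. -/
def conformal (φ : E → ℝ) (G : E → E →L[ℝ] E →L[ℝ] ℝ) (z : E) : E →L[ℝ] E →L[ℝ] ℝ :=
  Real.exp (2 * φ z) • G z

theorem IsMetricAt.conformal (h : IsMetricAt G z) (hφ : ContDiffAt ℝ 2 φ z) :
    IsMetricAt (conformal φ G) z where
  contDiffAt := (contDiffAt_const.mul hφ).exp.smul h.contDiffAt
  eventually_symm := by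
    filter_upwards [h.eventually_symm] with y hy u v
    simp [LocalGeometry.conformal, hy u v]
  isInvertible := isInvertible_smul (Real.exp_pos _).ne' h.isInvertible

theorem fderiv_conformal (h : DifferentiableAt ℝ G z) (hφ : DifferentiableAt ℝ φ z) (u v w : E) :
    fderiv ℝ (conformal φ G) z u v w =
      Real.exp (2 * φ z) * (fderiv ℝ G z u v w + 2 * fderiv ℝ φ z u * G z v w) := by
  have := ((hφ.hasFDerivAt.const_mul 2).exp).smul h.hasFDerivAt
  rw [show conformal φ G = (fun y ↦ Real.exp (2 * φ y)) • G from rfl, this.fderiv]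
  simp
  ring

theorem christoffel_conformal (h : IsMetricAt G z) (hφ : ContDiffAt ℝ 2 φ z) (u v : E) :
    christoffel (conformal φ G) z u v = christoffel G z u v + fderiv ℝ φ z u • v
      + fderiv ℝ φ z v • u - G z u v • sharp (G z) (fderiv ℝ φ z) := by
  have h' := h.conformal hφ
  have hφ' := hφ.differentiableAt two_ne_zero
  refine eq_of_apply_eq h'.isInvertible fun w ↦ ?_
  rw [h'.apply_christoffel, christoffelFirst_apply]
  simp only [fderiv_conformal h.differentiableAt hφ', conformal, _root_.smul_apply,
    map_add, map_sub, map_smul, _root_.add_apply, _root_.sub_apply,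
    h.apply_christoffel, christoffelFirst_apply, apply_sharp h.isInvertible, smul_eq_mul]
  ring

/-- `∇_u (grad φ)` corresponds to the Hessian of `φ`. -/
theorem hasFDerivAt_sharp [CompleteSpace E] (h : IsMetricAt G z) (hφ : ContDiffAt ℝ 2 φ z) :
    HasFDerivAt (fun y ↦ sharp (G y) (fderiv ℝ φ y))
      (sharp (G z) ∘L hessian G φ z - (christoffel G z).flip (sharp (G z) (fderiv ℝ φ z))) z := by
  have hα : DifferentiableAt ℝ (fderiv ℝ φ) z :=
    (hφ.fderiv_right (m := 1) (by norm_num)).differentiableAt one_ne_zero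
  have h₂ : DifferentiableAt ℝ (fun y ↦ sharp (G y)) z :=
    h.contDiffAt_sharp.differentiableAt two_ne_zero
  have hX : DifferentiableAt ℝ (fun y ↦ sharp (G y) (fderiv ℝ φ y)) z := h₂.clm_apply hα
  convert hX.hasFDerivAt using 1
  ext u
  refine eq_of_apply_eq h.isInvertible fun w ↦ ?_
  have e : (fun y ↦ G y (sharp (G y) (fderiv ℝ φ y))) =ᶠ[𝓝 z] fderiv ℝ φ := by
    filter_upwards [h.eventually] with y hy using apply_sharp hy.isInvertible _
  have d := (h.differentiableAt.hasFDerivAt.clm_apply hX.hasFDerivAt).congr_of_eventuallyEq e.symm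
  have d' := congrArg (fun L : E →L[ℝ] E →L[ℝ] ℝ ↦ L u w) (d.unique hα.hasFDerivAt)
  simp only [_root_.add_apply, ContinuousLinearMap.comp_apply,
    ContinuousLinearMap.flip_apply, h.fderiv_apply] at d'
  simp only [_root_.sub_apply, ContinuousLinearMap.comp_apply,
    ContinuousLinearMap.flip_apply, map_sub, apply_sharp h.isInvertible, hessian_apply]
  have s := h.symm (christoffel G z u w) (sharp (G z) (fderiv ℝ φ z))
  rw [apply_sharp h.isInvertible] at s
  linarith

theorem hessian_symm (h : IsMetricAt G z) (hφ : ContDiffAt ℝ 2 φ z) (u v : E) :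
    hessian G φ z u v = hessian G φ z v u := by
  rw [hessian_apply, hessian_apply, h.christoffel_symm u v,
    (hφ.isSymmSndFDerivAt (by simp)).eq u v]

theorem fderiv_christoffel_conformal [CompleteSpace E] (h : IsMetricAt G z)
    (hφ : ContDiffAt ℝ 2 φ z) (u v x : E) :
    fderiv ℝ (christoffel (conformal φ G)) z u v x = fderiv ℝ (christoffel G) z u v x
      + fderiv ℝ (fderiv ℝ φ) z u v • x + fderiv ℝ (fderiv ℝ φ) z u x • v
      - (G z (christoffel G z u v) x + G z (christoffel G z u x) v) •
        sharp (G z) (fderiv ℝ φ z)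
      - G z v x • (sharp (G z) (hessian G φ z u)
        - christoffel G z u (sharp (G z) (fderiv ℝ φ z))) := by
  have hα : HasFDerivAt (fderiv ℝ φ) _ z :=
    ((hφ.fderiv_right (m := 1) (by norm_num)).differentiableAt one_ne_zero).hasFDerivAt
  have hΓ := h.differentiableAt_christoffel.hasFDerivAt
  have hΓ' := (h.conformal hφ).differentiableAt_christoffel.hasFDerivAt
  have c (w : E) := hasFDerivAt_const (𝕜 := ℝ) w z
  have e : (fun y ↦ christoffel (conformal φ G) y v x) =ᶠ[𝓝 z] fun y ↦
      christoffel G y v x + fderiv ℝ φ y v • x + fderiv ℝ φ y x • v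
        - G y v x • sharp (G y) (fderiv ℝ φ y) := by
    filter_upwards [h.eventually, hφ.eventually (by simp)] with y hy hφy
    exact christoffel_conformal hy hφy v x
  have d := (((((hΓ.clm_apply (c v)).clm_apply (c x)).add ((hα.clm_apply (c v)).smul (c x))).add
    ((hα.clm_apply (c x)).smul (c v))).sub
    (((h.differentiableAt.hasFDerivAt.clm_apply (c v)).clm_apply (c x)).smul
      (hasFDerivAt_sharp h hφ))).congr_of_eventuallyEq e
  have d' := congrArg (fun L : E →L[ℝ] E ↦ L u)
    (((hΓ'.clm_apply (c v)).clm_apply (c x)).unique d)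
  simp [h.fderiv_apply] at d'
  rw [d']
  module

theorem riemann_conformal [CompleteSpace E] (h : IsMetricAt G z) (hφ : ContDiffAt ℝ 2 φ z)
    (u v x : E) :
    riemann (conformal φ G) z v x u = riemann G z v x u
      + (hessian G φ z v x • -u + hessian G φ z x u • v + G z x u • sharp (G z) (hessian G φ z v)
        - G z v x • sharp (G z) (hessian G φ z u))
      + ((fderiv ℝ φ z v * fderiv ℝ φ z x) • u - (fderiv ℝ φ z x * fderiv ℝ φ z u) • v
        - (fderiv ℝ φ z (sharp (G z) (fderiv ℝ φ z)) * G z v x) • u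
        + (fderiv ℝ φ z (sharp (G z) (fderiv ℝ φ z)) * G z x u) • v
        - (fderiv ℝ φ z v * G z x u) • sharp (G z) (fderiv ℝ φ z)
        + (G z v x * fderiv ℝ φ z u) • sharp (G z) (fderiv ℝ φ z)) := by
  have hX (w : E) : G z w (sharp (G z) (fderiv ℝ φ z)) = fderiv ℝ φ z w := by
    rw [h.symm, apply_sharp h.isInvertible]
  rw [riemann_apply, riemann_apply, fderiv_christoffel_conformal h hφ,
    fderiv_christoffel_conformal h hφ]
  simp only [christoffel_conformal h hφ, map_add, map_sub, map_smul, hX, hessian_apply,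
    smul_eq_mul]
  rw [h.christoffel_symm v u, h.symm x u, h.symm v u, h.christoffel_symm x u,
    (hφ.isSymmSndFDerivAt (by simp)).eq v u, (hφ.isSymmSndFDerivAt (by simp)).eq x u,
    h.symm v (christoffel G z u x), h.symm u (christoffel G z v x)]
  module

theorem trace_sharp_comp (G : E → E →L[ℝ] E →L[ℝ] ℝ) (f : E → ℝ) (z : E) :
    LinearMap.trace ℝ E ((sharp (G z) ∘L hessian G f z : E →L[ℝ] E) : E →ₗ[ℝ] E) =
      laplace G f z := rfl

theorem apply_sharp_conformal (h : IsMetricAt G z) (α β : E →L[ℝ] ℝ) :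
    Real.exp (2 * φ z) * α (sharp (conformal φ G z) β) = α (sharp (G z) β) := by
  rw [conformal, sharp_smul (Real.exp_pos _).ne' h.isInvertible]
  simp [Real.exp_ne_zero]

section finrank

variable [FiniteDimensional ℝ E]

theorem ricci_conformal (h : IsMetricAt G z) (hφ : ContDiffAt ℝ 2 φ z) :
    ricci (conformal φ G) z = ricci G z
      - ((Module.finrank ℝ E : ℝ) - 2) •
        (hessian G φ z - (fderiv ℝ φ z).smulRight (fderiv ℝ φ z))
      - (laplace G φ z + ((Module.finrank ℝ E : ℝ) - 2) *
          fderiv ℝ φ z (sharp (G z) (fderiv ℝ φ z))) • G z := by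
  have : CompleteSpace E := FiniteDimensional.complete ℝ E
  ext v x
  set q := fderiv ℝ φ z (sharp (G z) (fderiv ℝ φ z)) with hq
  have e : riemann (conformal φ G) z v x = riemann G z v x
      + (-(hessian G φ z v x • LinearMap.id)
        + (hessian G φ z x : E →ₗ[ℝ] ℝ).smulRight v
        + (G z x : E →ₗ[ℝ] ℝ).smulRight (sharp (G z) (hessian G φ z v))
        - G z v x • ((sharp (G z) ∘L hessian G φ z : E →L[ℝ] E) : E →ₗ[ℝ] E))
      + ((fderiv ℝ φ z v * fderiv ℝ φ z x - q * G z v x) • LinearMap.id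
        - fderiv ℝ φ z x • (fderiv ℝ φ z : E →ₗ[ℝ] ℝ).smulRight v
        + q • (G z x : E →ₗ[ℝ] ℝ).smulRight v
        - fderiv ℝ φ z v • (G z x : E →ₗ[ℝ] ℝ).smulRight (sharp (G z) (fderiv ℝ φ z))
        + G z v x • (fderiv ℝ φ z : E →ₗ[ℝ] ℝ).smulRight (sharp (G z) (fderiv ℝ φ z))) := by
    ext u
    rw [riemann_conformal h hφ u v x]
    simp [← hq]
    module
  have hX (α : E →L[ℝ] ℝ) : G z x (sharp (G z) α) = α x := by
    rw [h.symm, apply_sharp h.isInvertible]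
  rw [ricci_apply, e]
  simp only [map_add, map_sub, map_neg, map_smul, LinearMap.trace_smulRight, LinearMap.trace_id,
    trace_sharp_comp, ContinuousLinearMap.coe_coe, hX, ← hq, _root_.sub_apply,
    _root_.smul_apply, ricci_apply, ContinuousLinearMap.smulRight_apply, smul_eq_mul]
  rw [h.symm x v, hessian_symm h hφ x v]
  ring

theorem scalar_conformal (h : IsMetricAt G z) (hφ : ContDiffAt ℝ 2 φ z) :
    Real.exp (2 * φ z) * scalar (conformal φ G) z = scalar G z
      - 2 * ((Module.finrank ℝ E : ℝ) - 1) * laplace G φ z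
      - ((Module.finrank ℝ E : ℝ) - 2) * ((Module.finrank ℝ E : ℝ) - 1) *
          fderiv ℝ φ z (sharp (G z) (fderiv ℝ φ z)) := by
  rw [scalar, ricci_conformal h hφ, conformal,
    metricTrace_smul_left (Real.exp_pos _).ne' h.isInvertible, ← mul_assoc,
    mul_inv_cancel₀ (Real.exp_pos _).ne', one_mul]
  simp only [metricTrace_sub, metricTrace_smul, metricTrace_self h.isInvertible,
    metricTrace_smulRight]
  rw [← scalar, ← laplace]
  ring

theorem laplace_conformal (h : IsMetricAt G z) (hφ : ContDiffAt ℝ 2 φ z) (f : E → ℝ) :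
    Real.exp (2 * φ z) * laplace (conformal φ G) f z = laplace G f z
      + ((Module.finrank ℝ E : ℝ) - 2) * fderiv ℝ f z (sharp (G z) (fderiv ℝ φ z)) := by
  have e : hessian (conformal φ G) f z = hessian G f z
      - (fderiv ℝ φ z).smulRight (fderiv ℝ f z) - (fderiv ℝ f z).smulRight (fderiv ℝ φ z)
      + fderiv ℝ f z (sharp (G z) (fderiv ℝ φ z)) • G z := by
    ext u v
    simp [hessian_apply, christoffel_conformal h hφ]
    ring
  rw [laplace, e, conformal,
    metricTrace_smul_left (Real.exp_pos _).ne' h.isInvertible, ← mul_assoc,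
    mul_inv_cancel₀ (Real.exp_pos _).ne', one_mul]
  simp only [metricTrace_add, metricTrace_sub, metricTrace_smul, metricTrace_self h.isInvertible,
    metricTrace_smulRight]
  rw [← laplace, apply_sharp_comm h.isInvertible h.symm (fderiv ℝ φ z)]
  ring

end finrank

end Conformal

end LocalGeometry

namespace LocalGeometry

variable {E : Type*} [NormedAddCommGroup E] [NormedSpace ℝ E]
  {E' : Type*} [NormedAddCommGroup E'] [NormedSpace ℝ E']

/-! ### Product metrics -/

/-- The bilinear form `S ⊕ T` on a product. -/
def prodForm (S : E →L[ℝ] E →L[ℝ] ℝ) (T : E' →L[ℝ] E' →L[ℝ] ℝ) :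
    (E × E') →L[ℝ] (E × E') →L[ℝ] ℝ :=
  ContinuousLinearMap.precomp ℝ (ContinuousLinearMap.fst ℝ E E') ∘L S ∘L
      ContinuousLinearMap.fst ℝ E E'
    + ContinuousLinearMap.precomp ℝ (ContinuousLinearMap.snd ℝ E E') ∘L T ∘L
      ContinuousLinearMap.snd ℝ E E'

@[simp]
theorem prodForm_apply (S : E →L[ℝ] E →L[ℝ] ℝ) (T : E' →L[ℝ] E' →L[ℝ] ℝ) (u v : E × E') :
    prodForm S T u v = S u.1 v.1 + T u.2 v.2 := rfl

/-- The product metric `GB ⊕ GF`. -/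
def prodMetric (GB : E → E →L[ℝ] E →L[ℝ] ℝ) (GF : E' → E' →L[ℝ] E' →L[ℝ] ℝ) (z : E × E') :
    (E × E') →L[ℝ] (E × E') →L[ℝ] ℝ :=
  prodForm (GB z.1) (GF z.2)

section prodForm

variable {S : E →L[ℝ] E →L[ℝ] ℝ} {T : E' →L[ℝ] E' →L[ℝ] ℝ}

theorem isInvertible_prodForm (hS : S.IsInvertible) (hT : T.IsInvertible) :
    (prodForm S T).IsInvertible := by
  refine ContinuousLinearMap.IsInvertible.of_inverse (g :=
    (sharp S ∘L ContinuousLinearMap.precomp ℝ (ContinuousLinearMap.inl ℝ E E')).prod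
      (sharp T ∘L ContinuousLinearMap.precomp ℝ (ContinuousLinearMap.inr ℝ E E'))) ?_ ?_
  · ext α v <;> simp [apply_sharp hS, apply_sharp hT, ← Prod.zero_eq_mk]
  · ext v
    · have e : (prodForm S T (v, 0)).comp (ContinuousLinearMap.inl ℝ E E') = S v := by
        ext; simp
      simp [e, sharp_apply hS]
    · have e : (prodForm S T (v, 0)).comp (ContinuousLinearMap.inr ℝ E E') = 0 := by
        ext; simp
      simp [e]
    · have e : (prodForm S T (0, v)).comp (ContinuousLinearMap.inl ℝ E E') = 0 := by
        ext; simp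
      simp [e]
    · have e : (prodForm S T (0, v)).comp (ContinuousLinearMap.inr ℝ E E') = T v := by
        ext; simp
      simp [e, sharp_apply hT]

theorem sharp_prodForm (hS : S.IsInvertible) (hT : T.IsInvertible) (α : (E × E') →L[ℝ] ℝ) :
    sharp (prodForm S T) α = (sharp S (α ∘L ContinuousLinearMap.inl ℝ E E'),
      sharp T (α ∘L ContinuousLinearMap.inr ℝ E E')) := by
  rw [sharp_eq_iff (isInvertible_prodForm hS hT)]
  ext v <;> simp [apply_sharp hS, apply_sharp hT, ← Prod.zero_eq_mk]

theorem metricTrace_prodForm [FiniteDimensional ℝ E] [FiniteDimensional ℝ E']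
    (hS : S.IsInvertible) (hT : T.IsInvertible)
    (S' : E →L[ℝ] E →L[ℝ] ℝ) (T' : E' →L[ℝ] E' →L[ℝ] ℝ) :
    metricTrace (prodForm S T) (prodForm S' T') = metricTrace S S' + metricTrace T T' := by
  rw [metricTrace, metricTrace, metricTrace, ← LinearMap.trace_prodMap']
  congr 1
  refine LinearMap.ext fun v ↦ ?_
  have e₁ : (prodForm S' T' v).comp (ContinuousLinearMap.inl ℝ E E') = S' v.1 := by
    ext; simp
  have e₂ : (prodForm S' T' v).comp (ContinuousLinearMap.inr ℝ E E') = T' v.2 := by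
    ext; simp
  simp [sharp_prodForm hS hT, e₁, e₂]

end prodForm

variable {GB : E → E →L[ℝ] E →L[ℝ] ℝ} {GF : E' → E' →L[ℝ] E' →L[ℝ] ℝ} {z : E × E'}

theorem IsMetricAt.prodMetric (hB : IsMetricAt GB z.1) (hF : IsMetricAt GF z.2) :
    IsMetricAt (prodMetric GB GF) z where
  contDiffAt := by
    have h₁ := hB.contDiffAt.comp z contDiffAt_fst
    have h₂ := hF.contDiffAt.comp z contDiffAt_snd
    exact (contDiffAt_const.clm_comp (h₁.clm_comp contDiffAt_const)).add
      (contDiffAt_const.clm_comp (h₂.clm_comp contDiffAt_const))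
  eventually_symm := by
    filter_upwards [continuousAt_fst.eventually hB.eventually_symm,
      continuousAt_snd.eventually hF.eventually_symm] with y h₁ h₂ u v
    simp [LocalGeometry.prodMetric, h₁ u.1, h₂ u.2]
  isInvertible := isInvertible_prodForm hB.isInvertible hF.isInvertible

theorem fderiv_prodMetric (hB : DifferentiableAt ℝ GB z.1) (hF : DifferentiableAt ℝ GF z.2)
    (u v w : E × E') :
    fderiv ℝ (prodMetric GB GF) z u v w =
      fderiv ℝ GB z.1 u.1 v.1 w.1 + fderiv ℝ GF z.2 u.2 v.2 w.2 := by
  have h₁ := hB.hasFDerivAt.comp z hasFDerivAt_fst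
  have h₂ := hF.hasFDerivAt.comp z hasFDerivAt_snd
  have d : DifferentiableAt ℝ (prodMetric GB GF) z :=
    ((differentiableAt_const _).clm_comp (h₁.differentiableAt.clm_comp
      (differentiableAt_const _))).add ((differentiableAt_const _).clm_comp
        (h₂.differentiableAt.clm_comp (differentiableAt_const _)))
  have c (x : E × E') := hasFDerivAt_const (𝕜 := ℝ) x z
  have c₁ (x : E) := hasFDerivAt_const (𝕜 := ℝ) x z
  have c₂ (x : E') := hasFDerivAt_const (𝕜 := ℝ) x z
  have l := (d.hasFDerivAt.clm_apply (c v)).clm_apply (c w)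
  have r := ((h₁.clm_apply (c₁ v.1)).clm_apply (c₁ w.1)).add
    ((h₂.clm_apply (c₂ v.2)).clm_apply (c₂ w.2))
  simpa using congrArg (fun L : (E × E') →L[ℝ] ℝ ↦ L u) (l.unique r)

theorem christoffel_prodMetric (hB : IsMetricAt GB z.1) (hF : IsMetricAt GF z.2)
    (u v : E × E') :
    christoffel (prodMetric GB GF) z u v =
      (christoffel GB z.1 u.1 v.1, christoffel GF z.2 u.2 v.2) := by
  have h := hB.prodMetric hF
  refine eq_of_apply_eq h.isInvertible fun w ↦ ?_
  rw [h.apply_christoffel, christoffelFirst_apply]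
  simp only [fderiv_prodMetric hB.differentiableAt hF.differentiableAt, prodMetric,
    prodForm_apply, hB.apply_christoffel, hF.apply_christoffel, christoffelFirst_apply]
  ring

variable [FiniteDimensional ℝ E] [FiniteDimensional ℝ E']

theorem fderiv_christoffel_prodMetric (hB : IsMetricAt GB z.1) (hF : IsMetricAt GF z.2)
    (u v x : E × E') :
    fderiv ℝ (christoffel (prodMetric GB GF)) z u v x =
      (fderiv ℝ (christoffel GB) z.1 u.1 v.1 x.1, fderiv ℝ (christoffel GF) z.2 u.2 v.2 x.2) := by
  have : CompleteSpace E := FiniteDimensional.complete ℝ E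
  have : CompleteSpace E' := FiniteDimensional.complete ℝ E'
  have h₁ := hB.differentiableAt_christoffel.hasFDerivAt.comp z hasFDerivAt_fst
  have h₂ := hF.differentiableAt_christoffel.hasFDerivAt.comp z hasFDerivAt_snd
  have d := (hB.prodMetric hF).differentiableAt_christoffel
  have c (x : E × E') := hasFDerivAt_const (𝕜 := ℝ) x z
  have c₁ (x : E) := hasFDerivAt_const (𝕜 := ℝ) x z
  have c₂ (x : E') := hasFDerivAt_const (𝕜 := ℝ) x z
  have e : (fun y ↦ christoffel (prodMetric GB GF) y v x) =ᶠ[𝓝 z] fun y ↦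
      (christoffel GB y.1 v.1 x.1, christoffel GF y.2 v.2 x.2) := by
    filter_upwards [continuousAt_fst.eventually hB.eventually,
      continuousAt_snd.eventually hF.eventually] with y a b
    exact christoffel_prodMetric a b v x
  have l := (d.hasFDerivAt.clm_apply (c v)).clm_apply (c x)
  have r := (((h₁.clm_apply (c₁ v.1)).clm_apply (c₁ x.1)).prodMk
    ((h₂.clm_apply (c₂ v.2)).clm_apply (c₂ x.2))).congr_of_eventuallyEq e
  simpa using congrArg (fun L : (E × E') →L[ℝ] (E × E') ↦ L u) (l.unique r)

theorem ricci_prodMetric (hB : IsMetricAt GB z.1) (hF : IsMetricAt GF z.2) :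
    ricci (prodMetric GB GF) z = prodForm (ricci GB z.1) (ricci GF z.2) := by
  refine ContinuousLinearMap.ext fun v ↦ ContinuousLinearMap.ext fun x ↦ ?_
  rw [prodForm_apply, ricci_apply, ricci_apply, ricci_apply, ← LinearMap.trace_prodMap']
  congr 1
  refine LinearMap.ext fun u ↦ ?_
  simp [riemann_apply, fderiv_christoffel_prodMetric hB hF, christoffel_prodMetric hB hF]

theorem scalar_prodMetric (hB : IsMetricAt GB z.1) (hF : IsMetricAt GF z.2) :
    scalar (prodMetric GB GF) z = scalar GB z.1 + scalar GF z.2 := by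
  rw [scalar, ricci_prodMetric hB hF, prodMetric,
    metricTrace_prodForm hB.isInvertible hF.isInvertible]
  rfl

theorem laplace_comp_fst (hB : IsMetricAt GB z.1) (hF : IsMetricAt GF z.2) {f : E → ℝ}
    (hf : ContDiffAt ℝ 2 f z.1) :
    laplace (prodMetric GB GF) (fun y ↦ f y.1) z = laplace GB f z.1 := by
  have e : fderiv ℝ (fun y : E × E' ↦ f y.1) =ᶠ[𝓝 z]
      fun y ↦ fderiv ℝ f y.1 ∘L ContinuousLinearMap.fst ℝ E E' := by
    filter_upwards [continuousAt_fst.eventually (hf.eventually (by simp))] with y hy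
    exact ((hy.differentiableAt two_ne_zero).hasFDerivAt.comp y hasFDerivAt_fst).fderiv
  have hα : HasFDerivAt (fderiv ℝ f) _ z.1 :=
    ((hf.fderiv_right (m := 1) (by norm_num)).differentiableAt one_ne_zero).hasFDerivAt
  have d := ((hα.comp z hasFDerivAt_fst).clm_comp
    (hasFDerivAt_const (ContinuousLinearMap.fst ℝ E E') z)).congr_of_eventuallyEq e
  have h : hessian (prodMetric GB GF) (fun y ↦ f y.1) z = prodForm (hessian GB f z.1) 0 := by
    refine ContinuousLinearMap.ext fun u ↦ ContinuousLinearMap.ext fun v ↦ ?_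
    rw [hessian_apply, d.fderiv, e.self_of_nhds, christoffel_prodMetric hB hF]
    simp [hessian_apply]
  rw [laplace, h, prodMetric, metricTrace_prodForm hB.isInvertible hF.isInvertible]
  simp [metricTrace, laplace]

omit [FiniteDimensional ℝ E] [FiniteDimensional ℝ E'] in
theorem fderiv_comp_fst_sharp (hB : IsMetricAt GB z.1) (hF : IsMetricAt GF z.2) {f h : E → ℝ}
    (hf : DifferentiableAt ℝ f z.1) (hh : DifferentiableAt ℝ h z.1) :
    fderiv ℝ (fun y : E × E' ↦ f y.1) z
        (sharp (prodMetric GB GF z) (fderiv ℝ (fun y : E × E' ↦ h y.1) z)) =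
      fderiv ℝ f z.1 (sharp (GB z.1) (fderiv ℝ h z.1)) := by
  have e (f : E → ℝ) (hf : DifferentiableAt ℝ f z.1) : fderiv ℝ (fun y : E × E' ↦ f y.1) z =
      fderiv ℝ f z.1 ∘L ContinuousLinearMap.fst ℝ E E' :=
    (hf.hasFDerivAt.comp z hasFDerivAt_fst).fderiv
  rw [e f hf, e h hh, prodMetric, sharp_prodForm hB.isInvertible hF.isInvertible]
  congr 1

/-! ### Functions of functions -/

section

variable {G : E → E →L[ℝ] E →L[ℝ] ℝ} {x : E} {φ ψ : E → ℝ}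

omit [FiniteDimensional ℝ E] in
theorem laplace_sub (hφ : ContDiffAt ℝ 2 φ x) (hψ : ContDiffAt ℝ 2 ψ x) :
    laplace G (fun y ↦ φ y - ψ y) x = laplace G φ x - laplace G ψ x := by
  have e : fderiv ℝ (fun y ↦ φ y - ψ y) =ᶠ[𝓝 x] fun y ↦ fderiv ℝ φ y - fderiv ℝ ψ y := by
    filter_upwards [hφ.eventually (by simp), hψ.eventually (by simp)] with y h₁ h₂
    exact fderiv_fun_sub (h₁.differentiableAt two_ne_zero) (h₂.differentiableAt two_ne_zero)
  have hα {φ : E → ℝ} (hφ : ContDiffAt ℝ 2 φ x) : DifferentiableAt ℝ (fderiv ℝ φ) x :=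
    (hφ.fderiv_right (m := 1) (by norm_num)).differentiableAt one_ne_zero
  rw [laplace, laplace, laplace, ← metricTrace_sub]
  congr 1
  ext u v
  simp only [hessian_apply, e.fderiv_eq, e.self_of_nhds, fderiv_fun_sub (hα hφ) (hα hψ),
    _root_.sub_apply]
  ring

omit [FiniteDimensional ℝ E] in
theorem fderiv_log {c : E → ℝ} (hc : DifferentiableAt ℝ c x) (h0 : c x ≠ 0) :
    fderiv ℝ (fun y ↦ Real.log (c y)) x = (c x)⁻¹ • fderiv ℝ c x :=
  (hc.hasFDerivAt.log h0).fderiv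

theorem laplace_log {c : E → ℝ} (hc : ContDiffAt ℝ 2 c x) (h0 : c x ≠ 0) :
    laplace G (fun y ↦ Real.log (c y)) x = laplace G c x / c x
      - fderiv ℝ c x (sharp (G x) (fderiv ℝ c x)) / c x ^ 2 := by
  have e : fderiv ℝ (fun y ↦ Real.log (c y)) =ᶠ[𝓝 x] fun y ↦ (c y)⁻¹ • fderiv ℝ c y := by
    filter_upwards [hc.eventually (by simp), hc.continuousAt.eventually_ne h0] with y h₁ h₂
    exact fderiv_log (h₁.differentiableAt two_ne_zero) h₂
  have hα : DifferentiableAt ℝ (fderiv ℝ c) x :=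
    (hc.fderiv_right (m := 1) (by norm_num)).differentiableAt one_ne_zero
  have d := (((hasDerivAt_inv h0).comp_hasFDerivAt x
    (hc.differentiableAt two_ne_zero).hasFDerivAt).smul hα.hasFDerivAt).congr_of_eventuallyEq e
  have h : hessian G (fun y ↦ Real.log (c y)) x = (c x)⁻¹ • hessian G c x
      - ((c x) ^ 2)⁻¹ • (fderiv ℝ c x).smulRight (fderiv ℝ c x) := by
    ext u v
    simp [hessian_apply, d.fderiv, e.self_of_nhds]
    ring
  rw [laplace, h, metricTrace_sub, metricTrace_smul, metricTrace_smul, metricTrace_smulRight,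
    ← laplace]
  ring

end

/-! ### Base conformal warped products in coordinates -/

theorem scalar_baseConformalWarped (hB : IsMetricAt GB z.1) (hF : IsMetricAt GF z.2)
    {c w : E → ℝ} (hc : ContDiffAt ℝ 2 c z.1) (hw : ContDiffAt ℝ 2 w z.1)
    (hc0 : 0 < c z.1) (hw0 : 0 < w z.1) {m k : ℝ} (hm : Module.finrank ℝ E = m)
    (hk : Module.finrank ℝ E' = k) :
    c z.1 ^ 2 * scalar (fun y ↦ prodForm (c y.1 ^ 2 • GB y.1) (w y.1 ^ 2 • GF y.2)) z =
      scalar GB z.1 + scalar GF z.2 * (c z.1 ^ 2 / w z.1 ^ 2)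
      - 2 * (m - 1) * (laplace GB c z.1 / c z.1)
      - 2 * k * (laplace GB w z.1 / w z.1)
      - (m - 4) * (m - 1) * (fderiv ℝ c z.1 (sharp (GB z.1) (fderiv ℝ c z.1)) / c z.1 ^ 2)
      - 2 * k * (m - 2) *
        (fderiv ℝ c z.1 (sharp (GB z.1) (fderiv ℝ w z.1)) / (w z.1 * c z.1))
      - k * (k - 1) * (fderiv ℝ w z.1 (sharp (GB z.1) (fderiv ℝ w z.1)) / w z.1 ^ 2) := by
  set φ : E → ℝ := fun y ↦ Real.log (c y) with hφ_def
  set ψ : E → ℝ := fun y ↦ Real.log (w y) with hψ_def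
  have hφ : ContDiffAt ℝ 2 φ z.1 := hc.log hc0.ne'
  have hψ : ContDiffAt ℝ 2 ψ z.1 := hw.log hw0.ne'
  have hχ : ContDiffAt ℝ 2 (fun y ↦ φ y - ψ y) z.1 := hφ.sub hψ
  have hψ' : ContDiffAt ℝ 2 (fun y : E × E' ↦ ψ y.1) z := hψ.comp z contDiffAt_fst
  have hB' := hB.conformal hχ
  have e : (fun y : E × E' ↦ prodForm (c y.1 ^ 2 • GB y.1) (w y.1 ^ 2 • GF y.2)) =ᶠ[𝓝 z]
      conformal (fun y ↦ ψ y.1) (prodMetric (conformal (fun y ↦ φ y - ψ y) GB) GF) := by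
    filter_upwards [continuousAt_fst.eventually (hc.continuousAt.eventually (lt_mem_nhds hc0)),
      continuousAt_fst.eventually (hw.continuousAt.eventually (lt_mem_nhds hw0))] with y h₁ h₂
    refine ContinuousLinearMap.ext fun u ↦ ContinuousLinearMap.ext fun v ↦ ?_
    have e₁ : Real.exp (2 * ψ y.1) = w y.1 ^ 2 := by
      rw [two_mul, Real.exp_add, Real.exp_log h₂, sq]
    have e₂ : Real.exp (2 * (φ y.1 - ψ y.1)) = c y.1 ^ 2 / w y.1 ^ 2 := by
      rw [two_mul, Real.exp_add, Real.exp_sub, Real.exp_log h₂, Real.exp_log h₁]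
      ring
    simp only [conformal, prodMetric, prodForm_apply, _root_.smul_apply, smul_eq_mul, e₁, e₂]
    have := h₂.ne'
    field_simp
  have hn : (Module.finrank ℝ (E × E') : ℝ) = m + k := by
    rw [Module.finrank_prod, ← hm, ← hk]; push_cast; rfl
  have s₁ := scalar_conformal (hB'.prodMetric hF) hψ'
  have s₂ := scalar_conformal hB hχ
  have s₃ := laplace_conformal hB hχ ψ
  have s₄ := apply_sharp_conformal (φ := fun y ↦ φ y - ψ y) hB (fderiv ℝ w z.1)
    (fderiv ℝ w z.1)
  rw [scalar_prodMetric hB' hF, laplace_comp_fst hB' hF hψ, fderiv_comp_fst_sharp hB' hF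
    (hψ.differentiableAt two_ne_zero) (hψ.differentiableAt two_ne_zero), ← scalar_congr e, hn]
    at s₁
  have e₁ : Real.exp (2 * ψ z.1) = w z.1 ^ 2 := by
    rw [two_mul, Real.exp_add, Real.exp_log hw0, sq]
  have e₂ : Real.exp (2 * (φ z.1 - ψ z.1)) = c z.1 ^ 2 / w z.1 ^ 2 := by
    rw [two_mul, Real.exp_add, Real.exp_sub, Real.exp_log hw0, Real.exp_log hc0]
    ring
  rw [fderiv_fun_sub (hφ.differentiableAt two_ne_zero) (hψ.differentiableAt two_ne_zero),
    fderiv_log (hc.differentiableAt two_ne_zero) hc0.ne',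
    fderiv_log (hw.differentiableAt two_ne_zero) hw0.ne'] at s₂ s₃
  rw [fderiv_log (hw.differentiableAt two_ne_zero) hw0.ne'] at s₁
  rw [laplace_sub hφ hψ, laplace_log hc hc0.ne', laplace_log hw hw0.ne'] at s₂
  simp only [e₁, e₂, hm, map_sub, map_smul, _root_.sub_apply, _root_.smul_apply,
    smul_eq_mul] at s₁ s₂ s₃ s₄
  rw [apply_sharp_comm hB.isInvertible hB.symm (fderiv ℝ w z.1) (fderiv ℝ c z.1)] at s₂ s₃
  generalize scalar (fun y : E × E' ↦ prodForm (c y.1 ^ 2 • GB y.1) (w y.1 ^ 2 • GF y.2)) z = S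
    at s₁ ⊢
  generalize scalar (conformal (fun y ↦ φ y - ψ y) GB) z.1 = S' at s₁ s₂
  generalize laplace (conformal (fun y ↦ φ y - ψ y) GB) ψ z.1 = L at s₁ s₃
  generalize fderiv ℝ w z.1 (sharp (conformal (fun y ↦ φ y - ψ y) GB z.1) (fderiv ℝ w z.1)) = Q
    at s₁ s₄
  have hw' := hw0.ne'
  have hc' := hc0.ne'
  have key : c z.1 ^ 2 * S = c z.1 ^ 2 / w z.1 ^ 2 * (w z.1 ^ 2 * S) := by field_simp
  rw [key, s₁]
  have expand : c z.1 ^ 2 / w z.1 ^ 2 * (S' + scalar GF z.2 - 2 * (m + k - 1) * L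
      - (m + k - 2) * (m + k - 1) * ((w z.1)⁻¹ * ((w z.1)⁻¹ * Q))) =
      c z.1 ^ 2 / w z.1 ^ 2 * S' + scalar GF z.2 * (c z.1 ^ 2 / w z.1 ^ 2)
      - 2 * (m + k - 1) * (c z.1 ^ 2 / w z.1 ^ 2 * L)
      - (m + k - 2) * (m + k - 1) * ((w z.1)⁻¹ * ((w z.1)⁻¹ * (c z.1 ^ 2 / w z.1 ^ 2 * Q))) := by
    ring
  rw [expand, s₂, s₃, s₄, laplace_log hw hw0.ne']
  ring

end LocalGeometry

namespace PseudoRiemannianMetric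

open LocalGeometry

section Chart

variable {E : Type*} [NormedAddCommGroup E] [NormedSpace ℝ E]
  {H : Type*} [TopologicalSpace H] {I : ModelWithCorners ℝ E H} [I.Boundaryless]
  {M : Type*} [TopologicalSpace M] [ChartedSpace H M] [IsManifold I ∞ M]

theorem mfderiv_extChartAt_symm_self (x : M) :
    mfderiv 𝓘(ℝ, E) I (extChartAt I x).symm (extChartAt I x x) = ContinuousLinearMap.id ℝ E := by
  have : IsManifold I 1 M := IsManifold.of_le (n := ∞) (by simp)
  have h := mfderivWithin_range_extChartAt_symm (I := I) (x := x)
  rwa [I.range_eq_univ, mfderivWithin_univ] at h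

theorem inChart_self (g : PseudoRiemannianMetric I M) (x : M) :
    g.inChart x (extChartAt I x x) = (g.val x : E →L[ℝ] E →L[ℝ] ℝ) := by
  have e (y : M) (hy : y = x) :
      (g.val y : E →L[ℝ] E →L[ℝ] ℝ) = (g.val x : E →L[ℝ] E →L[ℝ] ℝ) := by
    subst hy; rfl
  have h := mfderiv_extChartAt_symm_self (I := I) x
  refine ContinuousLinearMap.ext fun u ↦ ContinuousLinearMap.ext fun v ↦ ?_
  have hD (u : E) : (mfderiv 𝓘(ℝ, E) I (extChartAt I x).symm (extChartAt I x x) : E →L[ℝ] E) u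
      = u := by
    exact congrArg (fun L : E →L[ℝ] E ↦ L u) h
  change (g.val ((extChartAt I x).symm (extChartAt I x x)) : E →L[ℝ] E →L[ℝ] ℝ)
    ((mfderiv 𝓘(ℝ, E) I (extChartAt I x).symm (extChartAt I x x) : E →L[ℝ] E) u)
    ((mfderiv 𝓘(ℝ, E) I (extChartAt I x).symm (extChartAt I x x) : E →L[ℝ] E) v) = _
  rw [hD, hD, e _ (extChartAt_to_inv x)]
  rfl

theorem contMDiffAt_extChartAt_symm (x : M) :
    ContMDiffAt 𝓘(ℝ, E) I ∞ (extChartAt I x).symm (extChartAt I x x) :=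
  (contMDiffOn_extChartAt_symm x).contMDiffAt (extChartAt_target_mem_nhds x)

theorem contDiffAt_inChart (g : PseudoRiemannianMetric I M) (x : M) :
    ContDiffAt ℝ ∞ (g.inChart x) (extChartAt I x x) := by
  have : IsManifold I 1 M := IsManifold.of_le (n := ∞) (by simp)
  have hg := (contMDiffAt_hom_bundle _).1 (g.contMDiff x)
  have hφ := contMDiffAt_extChartAt_symm (I := I) x
  have hcomp := (ContMDiffAt.comp_of_eq hg.2 hφ (extChartAt_to_inv x)).contDiffAt
  refine hcomp.congr_of_eventuallyEq ?_
  filter_upwards [extChartAt_target_mem_nhds (I := I) x] with z hz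
  have hy : (extChartAt I x).symm z ∈ (chartAt H x).source := by
    simpa using (extChartAt I x).map_target hz
  have hy' : (extChartAt I x).symm z ∈ (trivializationAt E (TangentSpace I) x).baseSet := by
    simpa using hy
  have hsymm (u : E) : (trivializationAt E (TangentSpace I) x).symm ((extChartAt I x).symm z) u =
      mfderiv 𝓘(ℝ, E) I (extChartAt I x).symm z u := by
    rw [← Bundle.Trivialization.symmL_apply (R := ℝ) _ hy',
      TangentBundle.symmL_trivializationAt hy, I.range_eq_univ, mfderivWithin_univ,
      (extChartAt I x).right_inv hz]
    rfl
  refine ContinuousLinearMap.ext fun u ↦ ContinuousLinearMap.ext fun v ↦ ?_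
  have h := inCoordinates_apply_eq₂ (𝕜 := ℝ) (F₃ := ℝ) (E₃ := Bundle.Trivial M ℝ)
    (ϕ := g.val ((extChartAt I x).symm z)) (v := u) (w := v) hy' hy' (Set.mem_univ _)
  have htriv (t : ℝ) : Bundle.Trivialization.linearMapAt ℝ
      (trivializationAt ℝ (Bundle.Trivial M ℝ) x) ((extChartAt I x).symm z) t = t :=
    LinearMap.congr_fun
      (Bundle.Trivial.linearMapAt_trivialization ℝ M ℝ ((extChartAt I x).symm z)) t
  rw [hsymm, hsymm] at h
  exact (h.trans (htriv _)).symm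

theorem isMetricAt_inChart [FiniteDimensional ℝ E] (g : PseudoRiemannianMetric I M) (x : M) :
    IsMetricAt (g.inChart x) (extChartAt I x x) where
  contDiffAt := (g.contDiffAt_inChart x).of_le ENat.LEInfty.out
  eventually_symm := Eventually.of_forall fun z _ _ ↦ g.symm ((extChartAt I x).symm z) _ _
  isInvertible := g.inChart_self x ▸ g.isInvertible_val x

theorem contDiffAt_comp_extChartAt_symm {c : M → ℝ} (hc : ContMDiff I 𝓘(ℝ, ℝ) ∞ c) (x : M) :
    ContDiffAt ℝ ∞ (c ∘ (extChartAt I x).symm) (extChartAt I x x) :=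
  (ContMDiffAt.comp_of_eq (hc x) (contMDiffAt_extChartAt_symm x)
    (extChartAt_to_inv x)).contDiffAt

theorem fderiv_comp_extChartAt_symm {c : M → ℝ} (hc : ContMDiff I 𝓘(ℝ, ℝ) ∞ c) (x : M) :
    fderiv ℝ (c ∘ (extChartAt I x).symm) (extChartAt I x x) =
      (mfderiv I 𝓘(ℝ, ℝ) c x : E →L[ℝ] ℝ) := by
  have hφ := contMDiffAt_extChartAt_symm (I := I) x
  have h := mfderiv_comp_of_eq ((hc x).mdifferentiableAt (by simp))
    (hφ.mdifferentiableAt (by simp)) (extChartAt_to_inv x)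
  have e (y : M) (hy : y = x) :
      (mfderiv I 𝓘(ℝ, ℝ) c y : E →L[ℝ] ℝ) = (mfderiv I 𝓘(ℝ, ℝ) c x : E →L[ℝ] ℝ) := by
    subst hy; rfl
  rw [← mfderiv_eq_fderiv]
  refine h.trans (ContinuousLinearMap.ext fun v ↦ ?_)
  exact (congrArg (fun L : E →L[ℝ] ℝ ↦ L _) (e _ (extChartAt_to_inv x))).trans
    (congrArg (fun L : E →L[ℝ] E ↦ (mfderiv I 𝓘(ℝ, ℝ) c x : E →L[ℝ] ℝ) (L v))
      (mfderiv_extChartAt_symm_self (I := I) x))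

theorem fderiv_sharp_inChart [FiniteDimensional ℝ E] (g : PseudoRiemannianMetric I M)
    {c w : M → ℝ} (hc : ContMDiff I 𝓘(ℝ, ℝ) ∞ c) (hw : ContMDiff I 𝓘(ℝ, ℝ) ∞ w) (x : M) :
    fderiv ℝ (c ∘ (extChartAt I x).symm) (extChartAt I x x)
        (sharp (g.inChart x (extChartAt I x x))
          (fderiv ℝ (w ∘ (extChartAt I x).symm) (extChartAt I x x))) =
      g.val x (g.grad c x) (g.grad w x) := by
  rw [val_grad, fderiv_comp_extChartAt_symm hc, fderiv_comp_extChartAt_symm hw, inChart_self]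
  rfl

end Chart

section Product

variable {E : Type*} [NormedAddCommGroup E] [NormedSpace ℝ E]
  {H : Type*} [TopologicalSpace H] {I : ModelWithCorners ℝ E H} [I.Boundaryless]
  {M : Type*} [TopologicalSpace M] [ChartedSpace H M] [IsManifold I ∞ M]
  {E' : Type*} [NormedAddCommGroup E'] [NormedSpace ℝ E']
  {H' : Type*} [TopologicalSpace H'] {I' : ModelWithCorners ℝ E' H'} [I'.Boundaryless]
  {M' : Type*} [TopologicalSpace M'] [ChartedSpace H' M'] [IsManifold I' ∞ M']

theorem mfderiv_extChartAt_prod_symm (b : M) (f : M') {z : E × E'}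
    (h₁ : z.1 ∈ (extChartAt I b).target) (h₂ : z.2 ∈ (extChartAt I' f).target) :
    (mfderiv 𝓘(ℝ, E × E') (I.prod I') (extChartAt (I.prod I') (b, f)).symm z :
        E × E' →L[ℝ] E × E') =
      (mfderiv 𝓘(ℝ, E) I (extChartAt I b).symm z.1 : E →L[ℝ] E).prodMap
        (mfderiv 𝓘(ℝ, E') I' (extChartAt I' f).symm z.2 : E' →L[ℝ] E') := by
  have d₁ : MDifferentiableAt 𝓘(ℝ, E) I (extChartAt I b).symm z.1 :=
    ((contMDiffOn_extChartAt_symm (n := ∞) b).contMDiffAt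
      (extChartAt_target_mem_nhds' h₁)).mdifferentiableAt (by simp)
  have d₂ : MDifferentiableAt 𝓘(ℝ, E') I' (extChartAt I' f).symm z.2 :=
    ((contMDiffOn_extChartAt_symm (n := ∞) f).contMDiffAt
      (extChartAt_target_mem_nhds' h₂)).mdifferentiableAt (by simp)
  have k₁ := d₁.hasMFDerivAt.comp z (ContinuousLinearMap.fst ℝ E E').hasMFDerivAt
  have k₂ := d₂.hasMFDerivAt.comp z (ContinuousLinearMap.snd ℝ E E').hasMFDerivAt
  have k := (k₁.prodMk k₂).mfderiv
  have e : (⇑(extChartAt (I.prod I') (b, f)).symm : E × E' → M × M') =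
      fun y ↦ ((extChartAt I b).symm y.1, (extChartAt I' f).symm y.2) := by
    rfl
  rw [e]
  exact k

theorem inChart_baseConformalWarped (gB : PseudoRiemannianMetric I M)
    (gF : PseudoRiemannianMetric I' M') (c w : M → ℝ) (hc : ContMDiff I 𝓘(ℝ, ℝ) ∞ c)
    (hw : ContMDiff I 𝓘(ℝ, ℝ) ∞ w) (hc0 : ∀ x, 0 < c x) (hw0 : ∀ x, 0 < w x) (b : M) (f : M')
    {z : E × E'} (h₁ : z.1 ∈ (extChartAt I b).target) (h₂ : z.2 ∈ (extChartAt I' f).target) :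
    (gB.baseConformalWarped gF c w hc hw hc0 hw0).inChart (b, f) z =
      prodForm ((c ∘ (extChartAt I b).symm) z.1 ^ 2 • gB.inChart b z.1)
        ((w ∘ (extChartAt I b).symm) z.1 ^ 2 • gF.inChart f z.2) := by
  have hD := mfderiv_extChartAt_prod_symm (I := I) (I' := I') b f h₁ h₂
  have hD' (u : E × E') : (mfderiv 𝓘(ℝ, E × E') (I.prod I')
      (extChartAt (I.prod I') (b, f)).symm z : E × E' →L[ℝ] E × E') u =
      ((mfderiv 𝓘(ℝ, E) I (extChartAt I b).symm z.1 : E →L[ℝ] E) u.1,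
        (mfderiv 𝓘(ℝ, E') I' (extChartAt I' f).symm z.2 : E' →L[ℝ] E') u.2) :=
    congrArg (fun L : E × E' →L[ℝ] E × E' ↦ L u) hD
  have val (p : M × M') (u v : E × E') :
      ((gB.baseConformalWarped gF c w hc hw hc0 hw0).val p : E × E' →L[ℝ] E × E' →L[ℝ] ℝ) u v =
      c p.1 ^ 2 * (gB.val p.1 : E →L[ℝ] E →L[ℝ] ℝ) u.1 v.1
        + w p.1 ^ 2 * (gF.val p.2 : E' →L[ℝ] E' →L[ℝ] ℝ) u.2 v.2 := by
    have h : ((gB.baseConformalWarped gF c w hc hw hc0 hw0).val p :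
          E × E' →L[ℝ] E × E' →L[ℝ] ℝ) u v =
        c p.1 ^ 2 • gB.val p.1 (mfderiv (I.prod I') I Prod.fst p (u : TangentSpace (I.prod I') p))
            (mfderiv (I.prod I') I Prod.fst p (v : TangentSpace (I.prod I') p))
          + w p.1 ^ 2 • gF.val p.2
            (mfderiv (I.prod I') I' Prod.snd p (u : TangentSpace (I.prod I') p))
            (mfderiv (I.prod I') I' Prod.snd p (v : TangentSpace (I.prod I') p)) := rfl
    rw [mfderiv_fst, mfderiv_snd] at h
    exact h
  refine ContinuousLinearMap.ext fun u ↦ ContinuousLinearMap.ext fun v ↦ ?_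
  have k := val ((extChartAt (I.prod I') (b, f)).symm z)
    ((mfderiv 𝓘(ℝ, E × E') (I.prod I') (extChartAt (I.prod I') (b, f)).symm z :
      E × E' →L[ℝ] E × E') u)
    ((mfderiv 𝓘(ℝ, E × E') (I.prod I') (extChartAt (I.prod I') (b, f)).symm z :
      E × E' →L[ℝ] E × E') v)
  refine k.trans ?_
  rw [hD', hD']
  rfl

end Product

end PseudoRiemannianMetric

end

theorem mainTheorem6
    {E : Type*} [NormedAddCommGroup E] [NormedSpace ℝ E] [FiniteDimensional ℝ E]
    {H : Type*} [TopologicalSpace H] {I : ModelWithCorners ℝ E H} [I.Boundaryless]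
    {B : Type*} [TopologicalSpace B] [ChartedSpace H B] [IsManifold I ∞ B]
    {E' : Type*} [NormedAddCommGroup E'] [NormedSpace ℝ E'] [FiniteDimensional ℝ E']
    {H' : Type*} [TopologicalSpace H'] {I' : ModelWithCorners ℝ E' H'} [I'.Boundaryless]
    {F : Type*} [TopologicalSpace F] [ChartedSpace H' F] [IsManifold I' ∞ F]
    (m k : ℕ) (hm : 1 ≤ m) (hdimB : Module.finrank ℝ E = m) (hdimF : Module.finrank ℝ E' = k)
    (gB : PseudoRiemannianMetric I B) (gF : PseudoRiemannianMetric I' F)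
    (c w : B → ℝ) (hc : ContMDiff I 𝓘(ℝ, ℝ) ∞ c) (hw : ContMDiff I 𝓘(ℝ, ℝ) ∞ w)
    (hc0 : ∀ x, 0 < c x) (hw0 : ∀ x, 0 < w x) (b : B) (f : F) :
    c b ^ 2 * (gB.baseConformalWarped gF c w hc hw hc0 hw0).scalarCurvature (b, f) =
      gB.scalarCurvature b + gF.scalarCurvature f * (c b ^ 2 / w b ^ 2)
      - 2 * ((m : ℝ) - 1) * (gB.laplacian c b / c b)
      - 2 * (k : ℝ) * (gB.laplacian w b / w b)
      - ((m : ℝ) - 4) * ((m : ℝ) - 1) *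
        (gB.val b (gB.grad c b) (gB.grad c b) / c b ^ 2)
      - 2 * (k : ℝ) * ((m : ℝ) - 2) *
        (gB.val b (gB.grad w b) (gB.grad c b) / (w b * c b))
      - (k : ℝ) * ((k : ℝ) - 1) *
        (gB.val b (gB.grad w b) (gB.grad w b) / w b ^ 2) := by
  have hB := gB.isMetricAt_inChart b
  have hF := gF.isMetricAt_inChart f
  have hle : (2 : WithTop ℕ∞) ≤ ∞ := ENat.LEInfty.out
  have hc' := (PseudoRiemannianMetric.contDiffAt_comp_extChartAt_symm hc b).of_le hle
  have hw' := (PseudoRiemannianMetric.contDiffAt_comp_extChartAt_symm hw b).of_le hle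
  have hinv : (extChartAt I b).symm (extChartAt I b b) = b := extChartAt_to_inv b
  have key := LocalGeometry.scalar_baseConformalWarped
    (z := (extChartAt I b b, extChartAt I' f f)) hB hF hc' hw' (hc0 _) (hw0 _)
    (m := m) (k := k) (by rw [hdimB]) (by rw [hdimF])
  have e : (gB.baseConformalWarped gF c w hc hw hc0 hw0).inChart (b, f)
      =ᶠ[nhds (extChartAt I b b, extChartAt I' f f)] fun y ↦
        LocalGeometry.prodForm ((c ∘ (extChartAt I b).symm) y.1 ^ 2 • gB.inChart b y.1)
          ((w ∘ (extChartAt I b).symm) y.1 ^ 2 • gF.inChart f y.2) := by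
    filter_upwards [prod_mem_nhds (extChartAt_target_mem_nhds (I := I) b)
      (extChartAt_target_mem_nhds (I := I') f)] with y hy
    exact gB.inChart_baseConformalWarped gF c w hc hw hc0 hw0 b f hy.1 hy.2
  rw [← LocalGeometry.scalar_congr e, gB.fderiv_sharp_inChart hc hc,
    gB.fderiv_sharp_inChart hc hw, gB.fderiv_sharp_inChart hw hw,
    gB.symm b (gB.grad c b) (gB.grad w b)] at key
  simp only [Function.comp_apply, hinv] at key
  exact key
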